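/- Call a \emph{quasi-projective variety} a reduced (possibly reducible) complex scheme admitting a locally closed immersion into some $\mathbb{P}^n_{\mathbb{C}}$. Let $X$ and $Y$ be normal quasi-projective varieties with regular (algebraic) actions of $\mathbb{C}^*$ such that the fixed-point sets $X^{\mathbb{C}^*}$ and $Y^{\mathbb{C}^*}$ are finite. For $x\in X^{\mathbb{C}^*}$ let $X_x=\{p\in X : \lim_{\eta\to 0}\eta\cdot p=x\}$ be its attracting set, and let $\prec$ be the relation on $X^{\mathbb{C}^*}$ obtained as the transitive closure of the rule $\overline{X_x}\cap X_{x'}\neq\emptyset$ (closure in the Zariski topology); define $\prec$ on $Y^{\mathbb{C}^*}$ in the same way. Let $\pi:X\to Y$ be a $\mathbb{C}^*$-equivariant, surjective and projective morphism, and let $x,x'\in X^{\mathbb{C}^*}$. Then: 1. If $x\prec x'$, then $\pi(x)\prec\pi(x')$. 2. If $\pi(x)\prec\pi(x')$, then there are an even integer $m\geq 2$ and fixed points $x_1,x_2,x_2',x_3,x_3',\dots,x_{m-1},x_{m-1}',x_m\in X^{\mathbb{C}^*}$ such that $\pi(x_1)=\pi(x)$, $\pi(x_m)=\pi(x')$,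 $\pi(x_i)=\pi(x_i')$ for all $2\leq i\leq m-1$, and for all $1\leq i\leq m-1$ one has $x_i\prec x_{i+1}$ if $i$ is odd and $x_i'\prec x_{i+1}'$ if $i$ is even. -/

import Mathlib

open CategoryTheory AlgebraicGeometry MonoidalCategory CartesianMonoidalCategory

noncomputable section

namespace BBOrder

/-- Schemes over `Spec ℂ` (objects of this category carry their structure morphism `X.hom`). -/
abbrev CSch : Type 1 := Over (Spec (CommRingCat.of ℂ))

section Spaces

attribute [local instance] MvPolynomial.gradedAlgebra

/-- Projective space `ℙⁿ_ℂ = Proj ℂ[x₀, …, xₙ]`, with its structure morphism to `Spec ℂ`. -/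
def projSpace (n : ℕ) : CSch :=
  Over.mk (Y := Proj (MvPolynomial.homogeneousSubmodule (Fin (n + 1)) ℂ))
    (Proj.toSpecZero (MvPolynomial.homogeneousSubmodule (Fin (n + 1)) ℂ) ≫
      Spec.map (CommRingCat.ofHom
        (algebraMap ℂ (MvPolynomial.homogeneousSubmodule (Fin (n + 1)) ℂ 0))))

end Spaces

/-- The algebraic group `ℂ* = 𝔾ₘ = Spec ℂ[T, T⁻¹]`; its group structure is the one given by the
Hopf algebra structure of `ℂ[T, T⁻¹]` (`T` is group-like). -/
abbrev Gm : CSch :=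
  (Spec (CommRingCat.of (LaurentPolynomial ℂ))).asOver (Spec (CommRingCat.of ℂ))

/-- The affine line `𝔸¹ = Spec ℂ[T]`. -/
abbrev A1 : CSch :=
  (Spec (CommRingCat.of (Polynomial ℂ))).asOver (Spec (CommRingCat.of ℂ))

/-- The open inclusion `ℂ* ⊆ 𝔸¹`, `η ↦ η`, dual to `ℂ[T] ⊆ ℂ[T, T⁻¹]`. -/
def gmToA1 : Gm ⟶ A1 :=
  Over.homMk (Spec.map (CommRingCat.ofHom
    (Polynomial.toLaurentAlg (R := ℂ)).toRingHom)) (by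
      change Spec.map _ ≫ Spec.map _ = Spec.map _
      rw [← Spec.map_comp, ← CommRingCat.ofHom_comp, AlgHom.toRingHom_eq_coe,
        AlgHom.comp_algebraMap_of_tower])

/-- The origin `0 ∈ 𝔸¹(ℂ)`, dual to evaluation of polynomials at `0`. -/
def zeroA1 : 𝟙_ CSch ⟶ A1 :=
  Over.homMk (Spec.map (CommRingCat.ofHom
    (Polynomial.aeval (R := ℂ) (0 : ℂ)).toRingHom)) (by
      change Spec.map _ ≫ Spec.map _ = 𝟙 _
      rw [← Spec.map_comp, ← CommRingCat.ofHom_comp, AlgHom.toRingHom_eq_coe,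
        AlgHom.comp_algebraMap_of_tower]
      exact Spec.map_id _)

/-- A (possibly reducible) quasi-projective complex variety: a reduced scheme over `ℂ` that admits
a locally closed immersion over `ℂ` into some projective space. -/
structure IsQuasiProjectiveVariety (X : CSch) : Prop where
  isReduced : IsReduced X.left
  exists_immersion : ∃ (n : ℕ) (i : X ⟶ projSpace n), IsImmersion i.left

/-- A scheme is normal if all its local rings are integrally closed domains. -/
def IsNormal (X : Scheme.{0}) : Prop :=
  ∀ x : X, IsDomain (X.presheaf.stalk x) ∧ IsIntegrallyClosed (X.presheaf.stalk x)

/-- A morphism `π : X ⟶ Y` is projective if it factors as a closed immersion `X ⟶ Y × ℙⁿ`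
followed by the projection to `Y`, for some `n`. -/
def IsProjective {X Y : CSch} (π : X ⟶ Y) : Prop :=
  ∃ (n : ℕ) (i : X ⟶ Y ⊗ projSpace n), IsClosedImmersion i.left ∧ i ≫ fst Y (projSpace n) = π

/-- The set `X(ℂ)` of complex points. -/
abbrev Pt (X : CSch) : Type := 𝟙_ CSch ⟶ X

/-- The (closed) point of the underlying Zariski space of `X` given by a complex point. -/
def Pt.toSpace {X : CSch} (p : Pt X) : X.left :=
  p.left (IsLocalRing.closedPoint ℂ)

/-- The Zariski closure in `X(ℂ)` of a set of complex points. -/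
def zariskiClosure {X : CSch} (A : Set (Pt X)) : Set (Pt X) :=
  {p | p.toSpace ∈ closure (Pt.toSpace '' A)}

section Action

variable (X : CSch) [ModObj Gm X]

/-- The fixed points `X^{ℂ*}`: the points `p ∈ X(ℂ)` with `t · p = p` for all `t ∈ ℂ*`. -/
def FixedPt : Type := {p : Pt X // ∀ t : Pt Gm, t • p = p}

variable {X}

/-- The orbit morphism `ℂ* ⟶ X`, `η ↦ η · p`, of a complex point `p`. -/
def orbitMap (p : Pt X) : Gm ⟶ X :=
  (𝟙 Gm : Gm ⟶ Gm) • (toUnit Gm ≫ p)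

/-- `lim_{η → 0} η · p = x`: the orbit morphism `ℂ* ⟶ X` of `p` extends to a morphism `𝔸¹ ⟶ X`
that maps `0` to `x`. -/
def HasLimit (p x : Pt X) : Prop :=
  ∃ f : A1 ⟶ X, gmToA1 ≫ f = orbitMap p ∧ zeroA1 ≫ f = x

/-- The attracting set `X_x = {p ∈ X(ℂ) : lim_{η → 0} η · p = x}`. -/
def attractingSet (x : FixedPt X) : Set (Pt X) :=
  {p | HasLimit p x.1}

/-- The geometric (pre)order on `X^{ℂ*}`: the transitive closure of the relation
`closure(X_x) ∩ X_{x'} ≠ ∅`. -/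
def Prec : FixedPt X → FixedPt X → Prop :=
  Relation.TransGen fun x x' =>
    (zariskiClosure (attractingSet x) ∩ attractingSet x').Nonempty

variable {Y : CSch} [ModObj Gm Y]

/-- The map `X^{ℂ*} → Y^{ℂ*}` induced by an equivariant morphism `π : X ⟶ Y`. -/
def FixedPt.map (π : X ⟶ Y) [IsModHom Gm π] (x : FixedPt X) : FixedPt Y :=
  ⟨x.1 ≫ π, fun t => by rw [← IsModHom.map_smul, x.2 t]⟩

end Action

end BBOrder

end

/-! Part 1: an equivariant morphism carries limits to limits and, being continuous, closures into
closures. Part 2 rests on two lifts along the proper surjection `π`. By the valuative criterion at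
`0 ∈ 𝔸¹`, if `π(p)` has a limit then so does `p`, and it lies over that of `π(p)`
(`exists_mem_attractingSet_of_comp`). Hence `Y_y` lies in the image of the union of the closures of
`X_z`, `z` over `y`. Since `X^{ℂ*}` is finite and `π` is closed, this image is closed, so it
contains the closure of `Y_y`; thus each generating relation in `Y` lifts to one in `X`
(`exists_prec_lift`). Lifts of consecutive relations need only meet after applying `π`, which gives
the zigzag. -/

noncomputable section

open scoped MonObj

namespace BBOrder

/-! ### Properness of projective space and of projective morphisms. -/

section Spaces

attribute [local instance] MvPolynomial.gradedAlgebra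

lemma algebraMap_homogeneousSubmodule_zero_bijective (n : ℕ) :
    Function.Bijective (algebraMap ℂ (MvPolynomial.homogeneousSubmodule (Fin (n + 1)) ℂ 0)) := by
  refine ⟨fun a b h => MvPolynomial.C_injective _ _ (congrArg Subtype.val h), fun ⟨p, hp⟩ => ?_⟩
  have hp' : p.totalDegree = 0 := (MvPolynomial.totalDegree_zero_iff_isHomogeneous _).2 hp
  exact ⟨p.coeff 0, Subtype.ext (MvPolynomial.totalDegree_eq_zero_iff_eq_C.1 hp').symm⟩

instance isProper_projSpace_hom (n : ℕ) : IsProper (projSpace n).hom := by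
  have : IsIso (CommRingCat.ofHom
      (algebraMap ℂ (MvPolynomial.homogeneousSubmodule (Fin (n + 1)) ℂ 0))) := by
    rw [ConcreteCategory.isIso_iff_bijective]
    exact algebraMap_homogeneousSubmodule_zero_bijective n
  have : Algebra.FiniteType (MvPolynomial.homogeneousSubmodule (Fin (n + 1)) ℂ 0)
      (MvPolynomial (Fin (n + 1)) ℂ) := by
    refine RingHom.FiniteType.of_comp_finiteType
      (f := algebraMap ℂ (MvPolynomial.homogeneousSubmodule (Fin (n + 1)) ℂ 0)) ?_
    exact RingHom.finiteType_algebraMap.2 (inferInstanceAs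
      (Algebra.FiniteType ℂ (MvPolynomial (Fin (n + 1)) ℂ)))
  change IsProper (Proj.toSpecZero (MvPolynomial.homogeneousSubmodule (Fin (n + 1)) ℂ) ≫ Spec.map _)
  infer_instance

end Spaces

namespace IsQuasiProjectiveVariety

variable {X : CSch} (hX : IsQuasiProjectiveVariety X)
include hX

lemma isSeparated : IsSeparated X.hom := by
  obtain ⟨n, i, hi⟩ := hX.exists_immersion
  rw [← Over.w i]
  infer_instance

lemma locallyOfFiniteType : LocallyOfFiniteType X.hom := by
  obtain ⟨n, i, hi⟩ := hX.exists_immersion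
  rw [← Over.w i]
  infer_instance

end IsQuasiProjectiveVariety

lemma IsProjective.isProper {X Y : CSch} {π : X ⟶ Y} (hπ : IsProjective π) : IsProper π.left := by
  obtain ⟨n, i, hi, rfl⟩ := hπ
  have : IsProper (fst Y (projSpace n)).left :=
    inferInstanceAs (IsProper (Limits.pullback.fst Y.hom (projSpace n).hom))
  rw [Over.comp_left]
  infer_instance

lemma Pt.left_comp_hom {X : CSch} (p : Pt X) : p.left ≫ X.hom = 𝟙 _ :=
  Over.w p

lemma Pt.toSpace_comp {X Y : CSch} (p : Pt X) (f : X ⟶ Y) :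
    Pt.toSpace (p ≫ f) = f.left p.toSpace :=
  Scheme.Hom.comp_apply _ _ _

/-! ### Complex points as closed points. -/

section Points

variable {X : CSch} [LocallyOfFiniteType X.hom]

lemma Pt.isClosed_toSpace (p : Pt X) : IsClosed {p.toSpace} :=
  (pointEquivClosedPoint X.hom ⟨p.left, p.left_comp_hom⟩).2

lemma Pt.toSpace_injective : Function.Injective (Pt.toSpace (X := X)) := fun p q h =>
  Over.OverMorphism.ext
    (ext_of_apply_closedPoint_eq X.hom p.left_comp_hom q.left_comp_hom h)

lemma Pt.exists_toSpace_eq {x : X.left} (hx : IsClosed {x}) : ∃ p : Pt X, p.toSpace = x :=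
  ⟨Over.homMk (pointOfClosedPoint X.hom x hx) (pointOfClosedPoint_comp X.hom x hx),
    pointOfClosedPoint_apply X.hom x hx _⟩

lemma Pt.exists_toSpace_mem {Z : Set X.left} (hZ : IsClosed Z) (hne : Z.Nonempty) :
    ∃ p : Pt X, p.toSpace ∈ Z := by
  have : JacobsonSpace X.left := LocallyOfFiniteType.jacobsonSpace X.hom
  have h := JacobsonSpace.closure_inter_closedPoints hZ
  obtain ⟨x, hxZ, hx⟩ : (Z ∩ closedPoints X.left).Nonempty := by
    rw [← closure_nonempty_iff, h]
    exact hne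
  obtain ⟨p, rfl⟩ := Pt.exists_toSpace_eq hx
  exact ⟨p, hxZ⟩

/-- The fibre over `q` meets `Z` in a nonempty closed set, which has a closed point because `X` is
Jacobson. -/
lemma Pt.exists_comp_eq_of_mem_image {Y : CSch} [LocallyOfFiniteType Y.hom] (π : X ⟶ Y)
    {Z : Set X.left} (hZ : IsClosed Z) (q : Pt Y) (hq : q.toSpace ∈ π.left '' Z) :
    ∃ p : Pt X, p ≫ π = q ∧ p.toSpace ∈ Z := by
  obtain ⟨w, hw, hwq⟩ := hq
  obtain ⟨p, hpZ, hp⟩ := Pt.exists_toSpace_mem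
    (hZ.inter (q.isClosed_toSpace.preimage π.left.continuous)) ⟨w, hw, hwq⟩
  exact ⟨p, Pt.toSpace_injective (by rw [Pt.toSpace_comp]; exact hp), hpZ⟩

/-- Morphisms from a reduced scheme of finite type to a separated one are determined by their
effect on complex points. -/
lemma hom_ext_of_pt {W : CSch} [LocallyOfFiniteType W.hom] [IsReduced W.left] [IsSeparated X.hom]
    {f g : W ⟶ X} (h : ∀ p : Pt W, p ≫ f = p ≫ g) : f = g := by
  have : LocallyOfFiniteType (f.left ≫ X.hom) := by rw [Over.w]; infer_instance
  refine Over.OverMorphism.ext (ext_of_apply_eq X.hom Set.univ isClosed_univ.isLocallyClosed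
    dense_univ (fun w _ hw => ?_) (by rw [Over.w, Over.w]))
  obtain ⟨p, rfl⟩ := Pt.exists_toSpace_eq hw
  rw [← Pt.toSpace_comp, ← Pt.toSpace_comp, h]

end Points

end BBOrder

/-! ### Extension across one point by the valuative criterion. -/

namespace AlgebraicGeometry

open Scheme

lemma IsProper.exists_valuative_lift {X Y : Scheme.{0}} (π : X ⟶ Y) [IsProper π]
    {R K : CommRingCat.{0}} [IsDomain R] [ValuationRing R] (hK : IsField K) (φ : R ⟶ K)
    (hφ : @IsFractionRing R _ K _ φ.hom.toAlgebra) (i₁ : Spec K ⟶ X) (i₂ : Spec R ⟶ Y)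
    (w : i₁ ≫ π = Spec.map φ ≫ i₂) :
    ∃ l : Spec R ⟶ X, Spec.map φ ≫ l = i₁ ∧ l ≫ π = i₂ := by
  let := hK.toField
  let := φ.hom.toAlgebra
  let S : ValuativeCommSq π :=
    { R := R, K := K, i₁ := i₁, i₂ := i₂, commSq := ⟨w⟩ }
  have : S.commSq.HasLift := by
    have hπ := ‹IsProper π›
    rw [IsProper.eq_valuativeCriterion] at hπ
    exact hπ.1.1.1.existence S
  exact ⟨S.commSq.lift, S.commSq.fac_left, S.commSq.fac_right⟩

lemma Scheme.PartialMap.stalkSpecializes_fromSpecStalkOfMem {X Y : Scheme.{0}}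
    (f : X.PartialMap Y) {x y : X} (h : x ⤳ y) (hx : x ∈ f.domain) (hy : y ∈ f.domain) :
    Spec.map (X.presheaf.stalkSpecializes h) ≫ f.fromSpecStalkOfMem hy =
      f.fromSpecStalkOfMem hx := by
  rw [PartialMap.fromSpecStalkOfMem, PartialMap.fromSpecStalkOfMem, ← Category.assoc]
  congr 1
  rw [← cancel_mono f.domain.ι]
  simp

/-- A morphism defined on an open subscheme of an integral scheme that misses only a point with
valuative local ring extends, as soon as it lifts the restriction of a morphism along a
proper one. -/
lemma exists_extension_of_isProper {C U X Y : Scheme.{0}} [IsIntegral C] [X.IsSeparated] [Y.IsSeparated]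
    (j : U ⟶ C) [IsOpenImmersion j] [Nonempty U] (c : C) [ValuationRing (C.presheaf.stalk c)]
    (hc : ∀ x, x ≠ c → x ∈ Set.range j) (π : X ⟶ Y) [IsProper π]
    (g : U ⟶ X) (h : C ⟶ Y) (w : g ≫ π = j ≫ h) :
    ∃ f : C ⟶ X, j ≫ f = g ∧ f ≫ π = h := by
  let P : C.PartialMap X :=
    { domain := j.opensRange
      dense_domain := j.opensRange.2.dense (Set.range_nonempty _)
      hom := j.isoOpensRange.inv ≫ g }
  have hP : P.hom ≫ π = P.domain.ι ≫ h := by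
    simp [P, w]
  have hPK : P.fromFunctionField ≫ π = C.fromSpecStalk _ ≫ h := by
    simp only [PartialMap.fromFunctionField, PartialMap.fromSpecStalkOfMem, Category.assoc, hP]
    simp
  obtain ⟨l, hl₁, hl₂⟩ := IsProper.exists_valuative_lift π (K := C.functionField)
    (Field.toIsField _)
    (C.presheaf.stalkSpecializes (genericPoint_specializes c))
    (inferInstanceAs (IsFractionRing (C.presheaf.stalk c) C.functionField))
    P.fromFunctionField (C.fromSpecStalk c ≫ h) (by
      rw [hPK, SpecMap_stalkSpecializes_fromSpecStalk_assoc])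
  -- `Q` spreads the lift `l` out to a neighbourhood of `c`. It agrees with `P` at the generic
  -- point, so both define one rational map, whose domain is all of `C`.
  let Q := PartialMap.ofFromSpecStalk h π l hl₂
  have hQ : Q.toRationalMap = P.toRationalMap := by
    apply RationalMap.eq_of_fromFunctionField_eq
    rw [RationalMap.fromFunctionField_toRationalMap, RationalMap.fromFunctionField_toRationalMap]
    refine Eq.trans ?_ hl₁
    rw [← PartialMap.fromSpecStalkOfMem_ofFromSpecStalk h π l hl₂]
    exact (Q.stalkSpecializes_fromSpecStalkOfMem _ _ _).symm
  have htop : P.toRationalMap.domain = ⊤ := by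
    refine top_le_iff.1 fun x _ => ?_
    by_cases hx : x = c
    · rw [hx, ← hQ]
      exact Q.le_domain_toRationalMap (PartialMap.mem_domain_ofFromSpecStalk h π l hl₂)
    · exact P.le_domain_toRationalMap (hc x hx)
  let T := P.toRationalMap.toPartialMap
  have hT := P.toPartialMap_toRationalMap_restrict
  let e : C ⟶ P.toRationalMap.domain.toScheme := C.topIso.inv ≫ (C.isoOfEq htop).inv
  have he : P.domain.ι ≫ e = C.homOfLE P.le_domain_toRationalMap := by
    rw [← cancel_mono (Opens.ι _)]
    simp [e]
  let f : C ⟶ X := e ≫ T.hom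
  have hιf : C.homOfLE P.le_domain_toRationalMap ≫ T.hom = P.domain.ι ≫ f := by
    rw [← he]
    exact Category.assoc _ _ _
  have hf : j ≫ f = g := by
    have : j = j.isoOpensRange.hom ≫ P.domain.ι := by simp [P]
    rw [this, Category.assoc, ← hιf]
    refine (congrArg (j.isoOpensRange.hom ≫ ·) hT).trans ?_
    simp [P]
  have : IsDominant j := ⟨j.opensRange.2.dense (Set.range_nonempty _)⟩
  exact ⟨f, hf, ext_of_isDominant j (by rw [← Category.assoc, hf, w])⟩

end AlgebraicGeometry

/-! ### The affine line, its origin, and scaling by `t ∈ ℂ*`. -/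

namespace BBOrder

instance isIntegral_A1 : IsIntegral A1.left :=
  inferInstanceAs (IsIntegral (Spec (CommRingCat.of (Polynomial ℂ))))

instance isIntegral_Gm : IsIntegral Gm.left :=
  inferInstanceAs (IsIntegral (Spec (CommRingCat.of (LaurentPolynomial ℂ))))

instance locallyOfFiniteType_Gm : LocallyOfFiniteType Gm.hom := by
  have : Algebra.FiniteType (CommRingCat.of ℂ) (CommRingCat.of (LaurentPolynomial ℂ)) :=
    inferInstanceAs (Algebra.FiniteType ℂ (AddMonoidAlgebra ℂ ℤ))
  exact locallyOfFiniteType_specOverSpec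

instance isOpenImmersion_gmToA1 : IsOpenImmersion gmToA1.left :=
  IsOpenImmersion.of_isLocalization (R := Polynomial ℂ) (S := LaurentPolynomial ℂ) Polynomial.X

lemma range_gmToA1 : Set.range gmToA1.left =
    (PrimeSpectrum.basicOpen (Polynomial.X : Polynomial ℂ) : Set (PrimeSpectrum (Polynomial ℂ))) :=
  PrimeSpectrum.localization_away_comap_range (LaurentPolynomial ℂ) (Polynomial.X : Polynomial ℂ)

instance isDominant_gmToA1 : IsDominant gmToA1.left :=
  ⟨gmToA1.left.opensRange.2.dense (Set.range_nonempty _)⟩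

lemma zeroA1_toSpace_asIdeal : PrimeSpectrum.asIdeal (R := Polynomial ℂ) (Pt.toSpace zeroA1) =
    RingHom.ker (Polynomial.aeval (R := ℂ) (0 : ℂ)) := by
  change Ideal.comap (Polynomial.aeval (R := ℂ) (0 : ℂ)).toRingHom
    (IsLocalRing.maximalIdeal ℂ) = _
  rw [IsLocalRing.maximalIdeal_eq_bot]
  rfl

lemma mem_range_gmToA1 {c : A1.left} (hc : c ≠ Pt.toSpace zeroA1) :
    c ∈ Set.range gmToA1.left := by
  rw [range_gmToA1]
  intro (hX : Polynomial.X ∈ PrimeSpectrum.asIdeal (R := Polynomial ℂ) c)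
  refine hc (PrimeSpectrum.ext (R := Polynomial ℂ) ?_)
  rw [zeroA1_toSpace_asIdeal]
  have : (RingHom.ker (Polynomial.aeval (R := ℂ) (0 : ℂ))).IsMaximal :=
    RingHom.ker_isMaximal_of_surjective _ fun a => ⟨Polynomial.C a, by simp⟩
  refine (this.eq_of_le (PrimeSpectrum.isPrime (R := Polynomial ℂ) c).ne_top fun p hp => ?_).symm
  have hp : Polynomial.X ∣ p := by
    rw [Polynomial.X_dvd_iff, Polynomial.coeff_zero_eq_eval_zero]
    simpa only [RingHom.mem_ker, Polynomial.aeval_def, Polynomial.eval₂_eq_eval_map, Algebra.algebraMap_self, Polynomial.map_id] using hp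
  exact Ideal.mem_of_dvd _ hp hX

instance valuationRing_stalk_A1 (c : A1.left) : ValuationRing (A1.left.presheaf.stalk c) := by
  let c' : PrimeSpectrum (Polynomial ℂ) := c
  let : Algebra (Polynomial ℂ) (A1.left.presheaf.stalk c) :=
    StructureSheaf.stalkAlgebra (Polynomial ℂ) c'
  have : IsLocalization.AtPrime (A1.left.presheaf.stalk c) c'.asIdeal :=
    StructureSheaf.IsLocalization.to_stalk (Polynomial ℂ) c'
  -- Each ideal of the localization is extended from its contraction to `ℂ[T]`, which is principal.
  have : IsPrincipalIdealRing (A1.left.presheaf.stalk c) := ⟨fun I => by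
    rw [← IsLocalization.map_under c'.asIdeal.primeCompl _ I,
      ← Ideal.span_singleton_generator (I.under (Polynomial ℂ)),
      Ideal.map_span, Set.image_singleton]
    exact ⟨_, rfl⟩⟩
  infer_instance

lemma exists_scaling (t : Pt Gm) : ∃ m : A1 ⟶ A1,
    gmToA1 ≫ m = ((toUnit Gm ≫ t) * 𝟙 Gm) ≫ gmToA1 ∧ zeroA1 ≫ m = zeroA1 := by
  let e := Spec.mapMulEquiv (R := ℂ) (S := LaurentPolynomial ℂ) (T := LaurentPolynomial ℂ)
  obtain ⟨φ, hφ⟩ : ∃ φ : WithConv (LaurentPolynomial ℂ →ₐ[ℂ] LaurentPolynomial ℂ),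
    e φ = toUnit Gm ≫ t := e.surjective _
  have hid : e (.toConv (AlgHom.id ℂ _)) = 𝟙 Gm :=
    Over.OverMorphism.ext (Spec.map_id _)
  -- The morphism dual to `φ` is constant, so `φ` factors through `ℂ`; `a` is the coordinate of `t`.
  obtain ⟨a, ha⟩ : ∃ a : ℂ, φ.ofConv (.T 1) = .C a := by
    have hu : (toUnit Gm).left =
        Spec.map (CommRingCat.ofHom (algebraMap ℂ (LaurentPolynomial ℂ))) :=
      (Category.comp_id _).symm.trans (Over.w (toUnit Gm))
    obtain ⟨ψ, hψ⟩ : ∃ ψ : CommRingCat.of (LaurentPolynomial ℂ) ⟶ CommRingCat.of ℂ,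
      Spec.map ψ = t.left := Spec.map_surjective _
    have h : Spec.map (CommRingCat.ofHom φ.ofConv.toRingHom) =
        Spec.map (CommRingCat.ofHom (algebraMap ℂ (LaurentPolynomial ℂ))) ≫ Spec.map ψ := by
      rw [hψ, ← hu]
      exact congrArg (·.left) hφ
    rw [← Spec.map_comp] at h
    exact ⟨ψ.hom (.T 1), congrArg (·.hom (.T 1)) (Spec.map_injective h)⟩
  let α : Polynomial ℂ →ₐ[ℂ] Polynomial ℂ := Polynomial.aeval (.C a * .X)
  -- As `T` is group-like, the convolution product sends `T` to `φ(T) * T = aT`.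
  have hα : Polynomial.toLaurentAlg.comp α =
      (φ * .toConv (AlgHom.id ℂ _)).ofConv.comp Polynomial.toLaurentAlg := by
    ext
    simp [α, AlgHom.convMul_def, ha]
  have h0 : (Polynomial.aeval (R := ℂ) (0 : ℂ)).comp α = Polynomial.aeval (R := ℂ) (0 : ℂ) := by
    ext; simp [α]
  let m : A1 ⟶ A1 := (Spec.map (CommRingCat.ofHom α.toRingHom)).asOver _
  refine ⟨m, ?_, ?_⟩
  · rw [← hφ, ← hid, ← map_mul]
    refine Over.OverMorphism.ext ?_
    change Spec.map _ ≫ Spec.map _ = Spec.map _ ≫ Spec.map _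
    rw [← Spec.map_comp, ← Spec.map_comp, ← CommRingCat.ofHom_comp, ← CommRingCat.ofHom_comp]
    exact congrArg (fun f : _ →ₐ[ℂ] _ => Spec.map (CommRingCat.ofHom f.toRingHom)) hα
  · refine Over.OverMorphism.ext ?_
    change Spec.map _ ≫ Spec.map _ = Spec.map _
    rw [← Spec.map_comp, ← CommRingCat.ofHom_comp]
    exact congrArg (fun f : _ →ₐ[ℂ] _ => Spec.map (CommRingCat.ofHom f.toRingHom)) h0

end BBOrder

/-! ### Limits, fixed points and the order. -/

namespace BBOrder

lemma hom_ext_of_gmToA1 {X : CSch} [IsSeparated X.hom] {f g : A1 ⟶ X}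
    (h : gmToA1 ≫ f = gmToA1 ≫ g) : f = g :=
  Over.OverMorphism.ext (ext_of_isDominant_of_isSeparated X.hom (by rw [Over.w, Over.w])
    gmToA1.left (congrArg (·.left) h))

lemma scheme_isSeparated (X : CSch) [IsSeparated X.hom] : X.left.IsSeparated :=
  ⟨by rw [← Limits.terminal.comp_from X.hom]; infer_instance⟩

lemma exists_extension_A1 {X Y : CSch} [IsSeparated X.hom] [IsSeparated Y.hom] (π : X ⟶ Y)
    [IsProper π.left] (g : Gm ⟶ X) (h : A1 ⟶ Y) (w : g ≫ π = gmToA1 ≫ h) :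
    ∃ f : A1 ⟶ X, gmToA1 ≫ f = g ∧ f ≫ π = h := by
  have := scheme_isSeparated X
  have := scheme_isSeparated Y
  obtain ⟨f, hf, hfπ⟩ := exists_extension_of_isProper gmToA1.left (Pt.toSpace zeroA1)
    (fun _ => mem_range_gmToA1) π.left g.left h.left (congrArg (·.left) w)
  refine ⟨Over.homMk f ?_, Over.OverMorphism.ext hf, Over.OverMorphism.ext hfπ⟩
  rw [← Over.w π, ← Category.assoc, hfπ, Over.w]

lemma subset_zariskiClosure (A : Set (Pt X)) : A ⊆ zariskiClosure A := fun _ hp =>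
  subset_closure (Set.mem_image_of_mem _ hp)

lemma zariskiClosure_comp {X Y : CSch} {A : Set (Pt X)} {B : Set (Pt Y)} (π : X ⟶ Y)
    (h : ∀ p ∈ A, p ≫ π ∈ B) {p : Pt X} (hp : p ∈ zariskiClosure A) :
    p ≫ π ∈ zariskiClosure B := by
  change Pt.toSpace (p ≫ π) ∈ closure (Pt.toSpace '' B)
  rw [Pt.toSpace_comp]
  refine map_mem_closure π.left.continuous hp ?_
  rintro _ ⟨q, hq, rfl⟩
  exact ⟨q ≫ π, h q hq, Pt.toSpace_comp q π⟩

variable {X Y : CSch} [ModObj Gm X] [ModObj Gm Y]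

lemma orbitMap_comp (π : X ⟶ Y) [IsModHom Gm π] (p : Pt X) :
    orbitMap p ≫ π = orbitMap (p ≫ π) := by
  rw [orbitMap, IsModHom.map_smul, Category.assoc, orbitMap]

lemma HasLimit.comp {p x : Pt X} (h : HasLimit p x) (π : X ⟶ Y) [IsModHom Gm π] :
    HasLimit (p ≫ π) (x ≫ π) := by
  obtain ⟨f, hf, rfl⟩ := h
  exact ⟨f ≫ π, by rw [← Category.assoc, hf, orbitMap_comp], by rw [Category.assoc]⟩

/-- Limits are fixed points. -/
lemma HasLimit.smul_eq [IsSeparated X.hom] {p x : Pt X} (h : HasLimit p x) (t : Pt Gm) :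
    t • x = x := by
  obtain ⟨f, hf, rfl⟩ := h
  obtain ⟨m, hm, hm0⟩ := exists_scaling t
  have smul (a b : Gm ⟶ Gm) (c : Gm ⟶ X) : a • b • c = (a * b) • c := (mul_smul a b c).symm
  -- On `ℂ*` both sides are `η ↦ (tη) · p`; by density they agree on `𝔸¹`, and at `0` this reads `t
  -- • x = x`.
  have key : (toUnit A1 ≫ t) • f = m ≫ f := by
    apply hom_ext_of_gmToA1
    rw [ModObj.comp_smul, hf, ← Category.assoc, ← Category.assoc, hm, Category.assoc _ gmToA1, hf,
      orbitMap, ModObj.comp_smul, smul, ← Category.assoc,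
      toUnit_unique (gmToA1 ≫ toUnit A1) (toUnit Gm), Category.comp_id,
      toUnit_unique (_ ≫ toUnit Gm) (toUnit Gm)]
  have h := congrArg (zeroA1 ≫ ·) key
  simp only [ModObj.comp_smul, ← Category.assoc, hm0] at h
  rwa [toUnit_unique (zeroA1 ≫ toUnit A1) (𝟙 _), Category.id_comp] at h

/-- Being fixed is a condition on complex points only; as `ℂ*` is reduced, these determine the orbit
morphism. -/
lemma FixedPt.orbitMap_eq [IsSeparated X.hom] [LocallyOfFiniteType X.hom] (x : FixedPt X) :
    orbitMap x.1 = toUnit Gm ≫ x.1 := by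
  refine hom_ext_of_pt fun t => ?_
  rw [orbitMap, ModObj.comp_smul, ← Category.assoc, toUnit_unique (t ≫ toUnit Gm) (𝟙 _),
    Category.id_comp, Category.comp_id, x.2]

lemma FixedPt.hasLimit [IsSeparated X.hom] [LocallyOfFiniteType X.hom] (x : FixedPt X) :
    HasLimit x.1 x.1 := by
  refine ⟨toUnit A1 ≫ x.1, ?_, ?_⟩
  · rw [x.orbitMap_eq, ← Category.assoc, toUnit_unique (gmToA1 ≫ toUnit A1) (toUnit Gm)]
  · rw [← Category.assoc, toUnit_unique (zeroA1 ≫ toUnit A1) (𝟙 _), Category.id_comp]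

lemma Prec.refl [IsSeparated X.hom] [LocallyOfFiniteType X.hom] (x : FixedPt X) : Prec x x :=
  .single ⟨x.1, subset_zariskiClosure _ x.hasLimit, x.hasLimit⟩

lemma Prec.map {x x' : FixedPt X} (h : Prec x x') (π : X ⟶ Y) [IsModHom Gm π] :
    Prec (x.map π) (x'.map π) := by
  refine Relation.TransGen.lift (FixedPt.map π) (fun a b => ?_) x x' h
  rintro ⟨p, hpa, hpb⟩
  exact ⟨p ≫ π, zariskiClosure_comp π (fun q hq => HasLimit.comp hq π) hpa, HasLimit.comp hpb π⟩

/-! ### Lifting limits and relations along `π`. -/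

section Proper

variable [IsSeparated X.hom] [IsSeparated Y.hom] (π : X ⟶ Y) [IsModHom Gm π] [IsProper π.left]

/-- Limits lift along proper equivariant morphisms. -/
lemma exists_mem_attractingSet_of_comp {p : Pt X} {y : FixedPt Y}
    (h : p ≫ π ∈ attractingSet y) : ∃ z : FixedPt X, z.map π = y ∧ p ∈ attractingSet z := by
  obtain ⟨f, hf, hf0⟩ := h
  obtain ⟨g, hg, rfl⟩ := exists_extension_A1 π (orbitMap p) f (by rw [hf, orbitMap_comp])
  have hlim : HasLimit p (zeroA1 ≫ g) := ⟨g, hg, rfl⟩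
  exact ⟨⟨_, hlim.smul_eq⟩, Subtype.ext ((Category.assoc _ _ _).trans hf0), hlim⟩

variable [LocallyOfFiniteType X.hom] [LocallyOfFiniteType Y.hom] [Finite (FixedPt X)]
  [Surjective π.left]

lemma exists_prec_lift {y y' : FixedPt Y}
    (h : (zariskiClosure (attractingSet y) ∩ attractingSet y').Nonempty) :
    ∃ z z' : FixedPt X, z.map π = y ∧ z'.map π = y' ∧ Prec z z' := by
  obtain ⟨q, hq, hq'⟩ := h
  let Z : Set X.left := ⋃ z : {z : FixedPt X // z.map π = y},
    closure (Pt.toSpace '' attractingSet z.1)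
  have hZ : IsClosed Z := by
    have : Finite {z : FixedPt X // z.map π = y} := Subtype.finite
    exact isClosed_iUnion_of_finite fun _ => isClosed_closure
  have hqZ : q.toSpace ∈ π.left '' Z := by
    refine closure_minimal ?_ (π.left.isClosedMap _ hZ) hq
    rintro _ ⟨r, hr, rfl⟩
    obtain ⟨p, rfl, -⟩ := Pt.exists_comp_eq_of_mem_image π isClosed_univ r
      (by rw [Set.image_univ]; exact π.left.surjective _)
    obtain ⟨z, hz, hpz⟩ := exists_mem_attractingSet_of_comp π hr
    exact ⟨p.toSpace, Set.mem_iUnion.2 ⟨⟨z, hz⟩, subset_closure (Set.mem_image_of_mem _ hpz)⟩,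
      (Pt.toSpace_comp p π).symm⟩
  obtain ⟨p, rfl, hp⟩ := Pt.exists_comp_eq_of_mem_image π hZ q hqZ
  obtain ⟨⟨z, hz⟩, hpz⟩ := Set.mem_iUnion.1 hp
  obtain ⟨z', hz', hpz'⟩ := exists_mem_attractingSet_of_comp π hq'
  exact ⟨z, z', hz, hz', .single ⟨p, hpz, hpz'⟩⟩

/-- A relation between images lifts to a zigzag of relations whose consecutive ends have the same
image. -/
lemma exists_zigzag {y y' : FixedPt Y} (h : Prec y y') :
    ∃ (n : ℕ) (s e : ℕ → FixedPt X), (s 0).map π = y ∧ (e n).map π = y' ∧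
      (∀ i ≤ n, Prec (s i) (e i)) ∧ ∀ i < n, (e i).map π = (s (i + 1)).map π := by
  induction h using Relation.TransGen.head_induction_on with
  | single h =>
    obtain ⟨z, z', hz, hz', hzz'⟩ := exists_prec_lift π h
    exact ⟨0, fun _ => z, fun _ => z', hz, hz', fun _ _ => hzz', fun _ h => by omega⟩
  | head h _ ih =>
    obtain ⟨z, z', hz, hz', hzz'⟩ := exists_prec_lift π h
    obtain ⟨n, s, e, hs, he, hse, hes⟩ := ih
    refine ⟨n + 1, fun i => i.casesOn z s, fun i => i.casesOn z' e, hz, he, ?_, ?_⟩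
    · rintro (_ | i) hi
      · exact hzz'
      · exact hse i (by omega)
    · rintro (_ | i) hi
      · exact hz'.trans hs.symm
      · exact hes i (by omega)

/-- The zigzag has `n + 1` links; if `n` is odd, the trivial link `x ≺ x` is put in front to fix the
parity. -/
lemma exists_zigzag_even {x : FixedPt X} {y' : FixedPt Y} (h : Prec (x.map π) y') :
    ∃ (n : ℕ) (s e : ℕ → FixedPt X), Even n ∧ (s 0).map π = x.map π ∧ (e n).map π = y' ∧
      (∀ i ≤ n, Prec (s i) (e i)) ∧ ∀ i < n, (e i).map π = (s (i + 1)).map π := by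
  obtain ⟨n, s, e, hs, he, hse, hes⟩ := exists_zigzag π h
  rcases Nat.even_or_odd n with hn | hn
  · exact ⟨n, s, e, hn, hs, he, hse, hes⟩
  · refine ⟨n + 1, fun i => i.casesOn x s, fun i => i.casesOn x e, hn.add_one, rfl, he, ?_, ?_⟩
    · rintro (_ | i) hi
      · exact .refl x
      · exact hse i (by omega)
    · rintro (_ | i) hi
      · exact hs.symm
      · exact hes i (by omega)

end Proper

end BBOrder

end

theorem mainTheorem9
    (X Y : BBOrder.CSch) [ModObj BBOrder.Gm X] [ModObj BBOrder.Gm Y]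
    (hX : BBOrder.IsQuasiProjectiveVariety X) (hY : BBOrder.IsQuasiProjectiveVariety Y)
    (hXnormal : BBOrder.IsNormal X.left) (hYnormal : BBOrder.IsNormal Y.left)
    (hXfin : Finite (BBOrder.FixedPt X)) (hYfin : Finite (BBOrder.FixedPt Y))
    (π : X ⟶ Y) [IsModHom BBOrder.Gm π]
    (hsurj : Surjective π.left) (hproj : BBOrder.IsProjective π)
    (x x' : BBOrder.FixedPt X) :
    (BBOrder.Prec x x' → BBOrder.Prec (x.map π) (x'.map π)) ∧
    (BBOrder.Prec (x.map π) (x'.map π) →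
      ∃ (m : ℕ) (a b : ℕ → BBOrder.FixedPt X), 2 ≤ m ∧ Even m ∧
        (a 1).map π = x.map π ∧ (a m).map π = x'.map π ∧
        (∀ i, 2 ≤ i → i < m → (a i).map π = (b i).map π) ∧
        (∀ i, 1 ≤ i → i < m →
          (Odd i → BBOrder.Prec (a i) (a (i + 1))) ∧
          (Even i → BBOrder.Prec (b i) (b (i + 1))))) := by
  have := hX.isSeparated
  have := hX.locallyOfFiniteType
  have := hY.isSeparated
  have := hY.locallyOfFiniteType
  have := hproj.isProper
  refine ⟨fun h => h.map π, fun h => ?_⟩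
  obtain ⟨n, s, e, hn, hs, he, hse, hes⟩ := BBOrder.exists_zigzag_even π h
  -- Link `s (i - 1) ≺ e (i - 1)` joins positions `i` and `i + 1`, in `a` for odd `i` and in `b` for
  -- even `i`. The other sequence at `i` holds the end `e (i - 2)` of the previous link. The values
  -- at `0` and `b 1` are junk; `n` even gives `a (n + 2) = e n`.
  refine ⟨n + 2, fun i => if Odd i then s (i - 1) else e (i - 2),
    fun i => if Odd i then e (i - 2) else s (i - 1), by omega, hn.add (by decide), ?_, ?_, ?_, ?_⟩
  · simpa using hs
  · have : ¬ Odd (n + 2) := Nat.not_odd_iff_even.2 (hn.add (by decide))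
    simpa [this] using he
  · intro i hi hin
    obtain ⟨j, rfl⟩ := Nat.exists_eq_add_of_le' hi
    have := hes j (by omega)
    by_cases hj : Odd (j + 2)
    · simpa [hj] using this.symm
    · simpa [hj] using this
  · intro i hi hin
    obtain ⟨j, rfl⟩ := Nat.exists_eq_add_of_le' hi
    have := hse j (by omega)
    refine ⟨fun ho => ?_, fun hev => ?_⟩
    · have h2 : ¬ Odd (j + 1 + 1) := Nat.not_odd_iff_even.2 ho.add_one
      simpa [ho, h2] using this
    · have h1 : ¬ Odd (j + 1) := Nat.not_odd_iff_even.2 hev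
      have h2 : Odd (j + 1 + 1) := hev.add_one
      simpa [h1, h2] using this
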